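/- Let $\Omega\subset\mathbb{R}^3$ be a bounded, contractible Lipschitz domain, and let $(\cdot,\cdot)$ and $\|\cdot\|$ be the $L^2(\Omega)$ inner product and norm. Let $H_0^1$, $H_0(\mathrm{curl})$, $H_0(\mathrm{div})$ be the usual subspaces of $H^1(\Omega)$, $H(\mathrm{curl};\Omega)$, $H(\mathrm{div};\Omega)$ of fields with vanishing trace, tangential trace and normal trace on $\partial\Omega$ respectively, and let $L^2_0$ be the space of $L^2(\Omega)$ functions with zero mean. There is a constant $C>0$ depending only on $\Omega$ such that the following holds. Let $$0\to H_0^{1,h}\xrightarrow{\ \mathrm{grad}\ }H_0^h(\mathrm{curl})\xrightarrow{\ \mathrm{curl}\ }H_0^h(\mathrm{div})\xrightarrow{\ \mathrm{div}\ }L_0^{2,h}\to 0$$ be an exact finite element subcomplex of $0\to H_0^1\to H_0(\mathrm{curl})\to H_0(\mathrm{div})\to L_0^2\to 0$ (more generally, any exact subcomplex of finite-dimensional subspaces such that the fields in $H_0^h(\mathrm{curl})$ are essentially bounded). Let $\tau>0$ and $B_0\in H_0^h(\mathrm{div})$, and let $B_h\in C^1([0,\infty);H_0^h(\mathrm{div}))$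 with $B_h|_{t=0}=B_0$ and $E_h,j_h,H_h\in C^0([0,\infty);H_0^h(\mathrm{curl}))$ satisfy $$\begin{aligned} (\partial_t B_h,C_h)+(\mathrm{curl}\,E_h,C_h)&=0,\\ (E_h,F_h)+\tau((j_h\times H_h)\times H_h,F_h)&=0,\\ (j_h,K_h)&=(B_h,\mathrm{curl}\,K_h),\\ (H_h,D_h)&=(B_h,D_h) \end{aligned}$$ for all $t\ge 0$ and all $(C_h,F_h,K_h,D_h)\in H_0^h(\mathrm{div})\times H_0^h(\mathrm{curl})^3$. Then for all $t\ge0$: 1. $\partial_tB_h+\mathrm{curl}\,E_h=0$; 2. $\mathrm{div}\,B_h=\mathrm{div}\,B_0$; in particular, if $\mathrm{div}\,B_0=0$, then $\mathrm{div}\,B_h=0$; 3. the energy $\mathcal{E}_h:=\|B_h\|^2$ satisfies $\mathcal{E}_h(t)-\mathcal{E}_h(0)=-2\tau\int_0^t\|j_h\times H_h\|^2\,ds\le 0$. If moreover $\mathrm{div}\,B_0=0$, then for every $t\ge 0$ there exists $A_h\in H_0^h(\mathrm{curl})$ with $\mathrm{curl}\,A_h=B_h(t)$, the helicity $\mathcal{H}_h(t):=(A_h,B_h(t))$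 does not depend on the choice of such an $A_h$, and 4. $\mathcal{H}_h(t)-\mathcal{H}_h(0)=0$; 5. $C\,|\mathcal{H}_h(t)|\le\mathcal{E}_h(t)$. -/

import Mathlib

noncomputable section

namespace MagnetoFriction

open MeasureTheory Set
open scoped ContDiff RealInnerProductSpace

/-- Euclidean three-space. -/
abbrev R3 := EuclideanSpace ℝ (Fin 3)

/-- Scalar `L²(Ω)`. -/
abbrev L2S (Ω : Set R3) := Lp ℝ 2 (volume.restrict Ω)

/-- Vector-valued `L²(Ω)`. -/
abbrev L2V (Ω : Set R3) := Lp R3 2 (volume.restrict Ω)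

/-! ### Domains -/

/-- `Ω` is a bounded Lipschitz domain: open, connected, bounded, and near each boundary point, in
suitable Cartesian coordinates, the set of points above the graph of a Lipschitz function. -/
structure IsBoundedLipschitzDomain (Ω : Set R3) : Prop where
  isOpen : IsOpen Ω
  isConnected : IsConnected Ω
  isBounded : Bornology.IsBounded Ω
  lipschitz_boundary : ∀ p ∈ frontier Ω,
    ∃ (e : R3 ≃ᵃⁱ[ℝ] R3) (g : EuclideanSpace ℝ (Fin 2) → ℝ) (K : NNReal) (U : Set R3),
      LipschitzWith K g ∧ IsOpen U ∧ p ∈ U ∧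
        ∀ x ∈ U, x ∈ Ω ↔ g !₂[e x 0, e x 1] < e x 2

/-! ### Classical vector calculus -/

/-- The vector (cross) product on `ℝ³`. -/
def cross (a b : R3) : R3 := WithLp.toLp 2 (crossProduct a.ofLp b.ofLp)

/-- The partial derivative `∂ᵢ φₖ`. -/
def pd (φ : R3 → R3) (i k : Fin 3) (x : R3) : ℝ :=
  (fderiv ℝ φ x (EuclideanSpace.single i 1)) k

/-- The classical curl. -/
def cCurl (φ : R3 → R3) (x : R3) : R3 :=
  !₂[pd φ 1 2 x - pd φ 2 1 x, pd φ 2 0 x - pd φ 0 2 x, pd φ 0 1 x - pd φ 1 0 x]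

/-- The classical divergence. -/
def cDiv (φ : R3 → R3) (x : R3) : ℝ := ∑ i, pd φ i i x

/-- `φ ∈ C_c^∞(ℝ³; F)`. -/
def IsSmoothCpt {F : Type*} [NormedAddCommGroup F] [NormedSpace ℝ F] (φ : R3 → F) : Prop :=
  ContDiff ℝ ∞ φ ∧ HasCompactSupport φ

/-- `φ ∈ C_c^∞(Ω; F)`. -/
def IsTest {F : Type*} [NormedAddCommGroup F] [NormedSpace ℝ F] (Ω : Set R3) (φ : R3 → F) :
    Prop :=
  IsSmoothCpt φ ∧ tsupport φ ⊆ Ω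

/-! ### Weak differential operators on `Ω` -/

/-- `g` is the weak gradient of `u` in `Ω`. -/
def HasWeakGrad (Ω : Set R3) (u : L2S Ω) (g : L2V Ω) : Prop :=
  ∀ φ : R3 → R3, IsTest Ω φ → ∫ x in Ω, ⟪g x, φ x⟫ = - ∫ x in Ω, u x * cDiv φ x

/-- `w` is the weak curl of `v` in `Ω`. -/
def HasWeakCurl (Ω : Set R3) (v w : L2V Ω) : Prop :=
  ∀ φ : R3 → R3, IsTest Ω φ → ∫ x in Ω, ⟪w x, φ x⟫ = ∫ x in Ω, ⟪v x, cCurl φ x⟫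

/-- `d` is the weak divergence of `v` in `Ω`. -/
def HasWeakDiv (Ω : Set R3) (v : L2V Ω) (d : L2S Ω) : Prop :=
  ∀ φ : R3 → ℝ, IsTest Ω φ → ∫ x in Ω, d x * φ x = - ∫ x in Ω, ⟪v x, gradient φ x⟫

/-- `u ∈ H¹(Ω)`. -/
def MemH1 (Ω : Set R3) (u : L2S Ω) : Prop := ∃ g, HasWeakGrad Ω u g

/-- `v ∈ H(curl, Ω)`. -/
def MemHCurl (Ω : Set R3) (v : L2V Ω) : Prop := ∃ w, HasWeakCurl Ω v w

/-- `v ∈ H(div, Ω)`. -/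
def MemHDiv (Ω : Set R3) (v : L2V Ω) : Prop := ∃ d, HasWeakDiv Ω v d

open Classical in
/-- The weak gradient of a member of `H¹(Ω)`; the value is zero elsewhere. -/
def wGrad (Ω : Set R3) (u : L2S Ω) : L2V Ω := if h : MemH1 Ω u then h.choose else 0

open Classical in
/-- The weak curl of a member of `H(curl, Ω)`; the value is zero elsewhere. -/
def wCurl (Ω : Set R3) (v : L2V Ω) : L2V Ω := if h : MemHCurl Ω v then h.choose else 0

open Classical in
/-- The weak divergence of a member of `H(div, Ω)`; the value is zero elsewhere. -/
def wDiv (Ω : Set R3) (v : L2V Ω) : L2S Ω := if h : MemHDiv Ω v then h.choose else 0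

/-! ### Boundary traces and the spaces with homogeneous boundary conditions

The traces are the usual ones defined by Green's formulas: functionals of the boundary values of
smooth fields. -/

/-- The trace of `u ∈ H¹(Ω)`, acting on smooth fields: `φ ↦ ∫_{∂Ω} u φ·n`. -/
def trace (Ω : Set R3) (u : L2S Ω) (φ : R3 → R3) : ℝ :=
  (∫ x in Ω, ⟪wGrad Ω u x, φ x⟫) + ∫ x in Ω, u x * cDiv φ x

/-- The tangential trace of `v ∈ H(curl, Ω)`, acting on smooth fields:
`φ ↦ ∫_{∂Ω} (n × v)·φ`. -/
def tangentialTrace (Ω : Set R3) (v : L2V Ω) (φ : R3 → R3) : ℝ :=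
  (∫ x in Ω, ⟪wCurl Ω v x, φ x⟫) - ∫ x in Ω, ⟪v x, cCurl φ x⟫

/-- The normal trace of `v ∈ H(div, Ω)`, acting on smooth functions: `φ ↦ ∫_{∂Ω} (v·n) φ`. -/
def normalTrace (Ω : Set R3) (v : L2V Ω) (φ : R3 → ℝ) : ℝ :=
  (∫ x in Ω, wDiv Ω v x * φ x) + ∫ x in Ω, ⟪v x, gradient φ x⟫

/-- `u ∈ H₀¹(Ω)`. -/
def MemH10 (Ω : Set R3) (u : L2S Ω) : Prop :=
  MemH1 Ω u ∧ ∀ φ : R3 → R3, IsSmoothCpt φ → trace Ω u φ = 0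

/-- `v ∈ H₀(curl, Ω)`. -/
def MemH0Curl (Ω : Set R3) (v : L2V Ω) : Prop :=
  MemHCurl Ω v ∧ ∀ φ : R3 → R3, IsSmoothCpt φ → tangentialTrace Ω v φ = 0

/-- `v ∈ H₀(div, Ω)`. -/
def MemH0Div (Ω : Set R3) (v : L2V Ω) : Prop :=
  MemHDiv Ω v ∧ ∀ φ : R3 → ℝ, IsSmoothCpt φ → normalTrace Ω v φ = 0

/-- `q ∈ L₀²(Ω)`. -/
def MemL20 (Ω : Set R3) (q : L2S Ω) : Prop := ∫ x in Ω, q x = 0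

/-! ### Discrete de Rham complexes -/

/-- A finite-dimensional subcomplex
`0 → V0 → V1 → V2 → V3 → 0` of `0 → H₀¹ → H₀(curl) → H₀(div) → L₀² → 0`.
Of the finite element structure only the finite dimension and the essential boundedness of the
members of `V1` (which holds for piecewise polynomials, and makes the products of the scheme
integrable) are retained. -/
structure DiscreteComplex (Ω : Set R3) where
  V0 : Submodule ℝ (L2S Ω)
  V1 : Submodule ℝ (L2V Ω)
  V2 : Submodule ℝ (L2V Ω)
  V3 : Submodule ℝ (L2S Ω)
  finite0 : FiniteDimensional ℝ V0
  finite1 : FiniteDimensional ℝ V1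
  finite2 : FiniteDimensional ℝ V2
  finite3 : FiniteDimensional ℝ V3
  mem0 : ∀ u ∈ V0, MemH10 Ω u
  mem1 : ∀ v ∈ V1, MemH0Curl Ω v
  mem2 : ∀ v ∈ V2, MemH0Div Ω v
  mem3 : ∀ q ∈ V3, MemL20 Ω q
  bounded1 : ∀ v ∈ V1, MemLp v ⊤ (volume.restrict Ω)
  grad_mem : ∀ u ∈ V0, wGrad Ω u ∈ V1
  curl_mem : ∀ v ∈ V1, wCurl Ω v ∈ V2
  div_mem : ∀ v ∈ V2, wDiv Ω v ∈ V3

/-- Exactness of the discrete complex. (That it is a complex is part of the equivalences.) -/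
structure DiscreteComplex.IsExact {Ω : Set R3} (X : DiscreteComplex Ω) : Prop where
  exact0 : ∀ u ∈ X.V0, wGrad Ω u = 0 → u = 0
  exact1 : ∀ v ∈ X.V1, wCurl Ω v = 0 ↔ ∃ u ∈ X.V0, wGrad Ω u = v
  exact2 : ∀ v ∈ X.V2, wDiv Ω v = 0 ↔ ∃ w ∈ X.V1, wCurl Ω w = v
  exact3 : ∀ q ∈ X.V3, ∃ v ∈ X.V2, wDiv Ω v = q

/-! ### The semi-discrete scheme -/

/-- `∂ₜ B` on `[0, ∞)`, one-sided at `t = 0`. -/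
def timeDeriv {Ω : Set R3} {X : DiscreteComplex Ω} (B : ℝ → X.V2) (t : ℝ) : X.V2 :=
  derivWithin B (Ici 0) t

/-- `(B, E, j, H)` solves the semi-discrete magneto-frictional scheme on `[0, ∞)` with coupling
parameter `τ` and initial datum `B₀`. Values at negative times play no role. -/
structure IsSolution {Ω : Set R3} (X : DiscreteComplex Ω) (τ : ℝ) (B₀ : X.V2)
    (B : ℝ → X.V2) (E j H : ℝ → X.V1) : Prop where
  contDiffOn_B : ContDiffOn ℝ 1 B (Ici 0)
  continuousOn_E : ContinuousOn E (Ici 0)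
  continuousOn_j : ContinuousOn j (Ici 0)
  continuousOn_H : ContinuousOn H (Ici 0)
  initial : B 0 = B₀
  advection : ∀ t, 0 ≤ t → ∀ C ∈ X.V2,
    ⟪(timeDeriv B t : L2V Ω), C⟫ + ⟪wCurl Ω (E t), C⟫ = 0
  electric : ∀ t, 0 ≤ t → ∀ F ∈ X.V1,
    ⟪(E t : L2V Ω), F⟫ + τ * ∫ x in Ω,
      ⟪cross (cross ((j t : L2V Ω) x) ((H t : L2V Ω) x)) ((H t : L2V Ω) x), F x⟫ = 0
  current : ∀ t, 0 ≤ t → ∀ K ∈ X.V1,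
    ⟪(j t : L2V Ω), K⟫ = ⟪(B t : L2V Ω), wCurl Ω K⟫
  magnetic : ∀ t, 0 ≤ t → ∀ D ∈ X.V1,
    ⟪(H t : L2V Ω), D⟫ = ⟪(B t : L2V Ω), D⟫

/-- `‖v × w‖²`, the squared `L²(Ω)` norm of the cross product. -/
def crossNormSq {Ω : Set R3} (v w : L2V Ω) : ℝ := ∫ x in Ω, ‖cross (v x) (w x)‖ ^ 2

/-- `A ∈ V1` is a discrete magnetic potential of `b`. -/
def IsPotential {Ω : Set R3} (X : DiscreteComplex Ω) (b A : L2V Ω) : Prop :=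
  A ∈ X.V1 ∧ wCurl Ω A = b

end MagnetoFriction

end

noncomputable section

namespace MagnetoFriction

open MeasureTheory Set Filter Topology Convolution ContinuousLinearMap
open scoped ContDiff RealInnerProductSpace

/-!
Testing the scheme with `Eₕ`, `jₕ` and `Hₕ` gives `(Bₕ, curl Eₕ) = τ ‖jₕ × Hₕ‖²` and
`(Bₕ, Eₕ) = 0`. With `∂ₜBₕ = -curl Eₕ` the first identity is the energy law. Given a potential of
`B₀`, solving `∂ₜAₕ = -Eₕ` (the temporal gauge) yields potentials of all `Bₕ(t)`, and the second
identity together with the symmetry of the curl on `H₀(curl)` gives `d/dt (Aₕ, Bₕ) = 0`.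

For Arnold's inequality, extend `v ∈ H₀(curl)` and `w = curl v` by zero to `ℝ³`. If `φ` is smooth,
then `(w, ∂ₑφ - ∇(e · φ)) = (curl φ, e × w)`, and the gradient drops out because `w` is solenoidal.
Hence `s ↦ (w, φ(· + s e))` has derivative at most `‖curl φ‖ ‖w‖` for a unit vector `e`; as it
vanishes once the supports are disjoint, `|(w, φ)| ≤ const · ‖curl φ‖ ‖w‖`. Mollifications `φ → v`
with `curl φ → w` conclude. Their `L²` convergence is the continuity of translations in `L²`: a
mollification is an average, with values in `L²`, of translates.
-/

/-! ### Mollification in `L²` -/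

section Mollification

variable {G F : Type*} [NormedAddCommGroup G] [NormedSpace ℝ G] [FiniteDimensional ℝ G]
  [MeasurableSpace G] [BorelSpace G] {μ : Measure G} [μ.IsAddHaarMeasure] [NormedAddCommGroup F]

/-- The orbit `y ↦ v (y + ·)` of an `L²` function under translations. -/
def translates (v : Lp F 2 μ) (y : G) : Lp F 2 μ := DomAddAct.mk y +ᵥ v

theorem translates_zero (v : Lp F 2 μ) : translates v 0 = v := by
  simp [translates]

theorem norm_translates (v : Lp F 2 μ) (y : G) : ‖translates v y‖ = ‖v‖ :=
  DomAddAct.norm_vadd_Lp _ _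

theorem translates_toLp_ae_eq {v : G → F} (hv : MemLp v 2 μ) (y : G) :
    translates (hv.toLp v) y =ᵐ[μ] fun x => v (y + x) := by
  rw [translates, DomAddAct.mk_vadd_toLp]
  exact (hv.comp_measurePreserving (measurePreserving_vadd y μ)).coeFn_toLp

theorem continuous_translates (v : Lp F 2 μ) : Continuous (translates v) := by
  have : Fact ((2 : ENNReal) ≠ ⊤) := ⟨by norm_num⟩
  exact DomAddAct.continuous_mk.vadd continuous_const

variable [InnerProductSpace ℝ F]

theorem integrable_smul_translates {ρ : G → ℝ} (hρ : Integrable ρ μ) (v : Lp F 2 μ) :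
    Integrable (fun t => ρ t • translates v (0 - t)) μ :=
  hρ.smul_bdd (C := ‖v‖)
    ((continuous_translates v).comp (by fun_prop)).aestronglyMeasurable
    (.of_forall fun _ => (norm_translates _ _).le)

variable [CompleteSpace F]

theorem setIntegral_convolution_translates {ρ : G → ℝ} (hρ : Integrable ρ μ) {v : G → F}
    (hv : Integrable v μ) (hv2 : MemLp v 2 μ) {K : Set G} (hK : IsCompact K) :
    ∫ x in K, ((ρ ⋆[lsmul ℝ ℝ, μ] translates (hv2.toLp v)) 0 : Lp F 2 μ) x ∂μ =
      ∫ x in K, (ρ ⋆[lsmul ℝ ℝ, μ] v) x ∂μ := by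
  set b := (ρ ⋆[lsmul ℝ ℝ, μ] translates (hv2.toLp v)) 0
  let pairing (c : F) : Lp F 2 μ := indicatorConstLp 2 hK.measurableSet hK.measure_ne_top c
  have inner_pairing (c : F) (u : Lp F 2 μ) : ⟪pairing c, u⟫ = ⟪c, ∫ x in K, u x ∂μ⟫ :=
    L2.inner_indicatorConstLp_eq_inner_setIntegral ℝ _ _ _ _
  have htranslate (t : G) :
      ∫ x in K, translates (hv2.toLp v) (0 - t) x ∂μ = ∫ x in K, v (x - t) ∂μ := by
    refine integral_congr_ae (ae_restrict_of_ae ?_)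
    filter_upwards [translates_toLp_ae_eq hv2 (0 - t)] with x hx
    rw [hx, zero_sub, neg_add_eq_sub]
  have hprod : Integrable (fun p : G × G => ρ p.1 • v (p.2 - p.1)) (μ.prod (μ.restrict K)) :=
    ((hρ.convolution_integrand (lsmul ℝ ℝ) hv).mono_measure
      (Measure.prod_mono Measure.restrict_le_self le_rfl)).swap
  refine ext_inner_left ℝ fun c => ?_
  calc ⟪c, ∫ x in K, b x ∂μ⟫
      = ⟪pairing c, b⟫ := (inner_pairing c b).symm
    _ = ∫ t, ⟪pairing c, ρ t • translates (hv2.toLp v) (0 - t)⟫ ∂μ :=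
        (integral_inner (integrable_smul_translates hρ _) _).symm
    _ = ∫ t, ⟪c, ∫ x in K, ρ t • v (x - t) ∂μ⟫ ∂μ := by
        congr with t
        rw [inner_smul_right, inner_pairing, htranslate, integral_smul, inner_smul_right]
    _ = ⟪c, ∫ t, ∫ x in K, ρ t • v (x - t) ∂μ ∂μ⟫ := integral_inner hprod.integral_prod_left c
    _ = ⟪c, ∫ x in K, (ρ ⋆[lsmul ℝ ℝ, μ] v) x ∂μ⟫ := by
        rw [integral_integral_swap hprod]
        rfl

theorem convolution_translates_ae_eq {ρ : G → ℝ} (hρ : Integrable ρ μ) {v : G → F}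
    (hv : Integrable v μ) (hv2 : MemLp v 2 μ) :
    ((ρ ⋆[lsmul ℝ ℝ, μ] translates (hv2.toLp v)) 0 : Lp F 2 μ) =ᵐ[μ] ρ ⋆[lsmul ℝ ℝ, μ] v := by
  set b := (ρ ⋆[lsmul ℝ ℝ, μ] translates (hv2.toLp v)) 0
  have hb : LocallyIntegrable b μ := (Lp.memLp b).locallyIntegrable (by norm_num)
  have hρv : Integrable (ρ ⋆[lsmul ℝ ℝ, μ] v) μ := hρ.integrable_convolution _ hv
  rw [← sub_ae_eq_zero]
  refine ae_eq_zero_of_forall_setIntegral_isCompact_eq_zero'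
    (hb.sub hρv.locallyIntegrable) fun K hK => ?_
  simp only [Pi.sub_apply]
  rw [integral_sub (hb.integrableOn_isCompact hK) hρv.integrableOn,
    setIntegral_convolution_translates hρ hv hv2 hK, sub_self]

theorem tendsto_toLp_convolution {ι : Type*} {l : Filter ι} {φ : ι → ContDiffBump (0 : G)}
    (hφ : Tendsto (fun i => (φ i).rOut) l (𝓝 0)) {v : G → F} (hv : Integrable v μ)
    (hv2 : MemLp v 2 μ)
    (hφv : ∀ i, MemLp ((φ i).normed μ ⋆[lsmul ℝ ℝ, μ] v) 2 μ) :
    Tendsto (fun i => (hφv i).toLp) l (𝓝 (hv2.toLp v)) := by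
  have h := ContDiffBump.convolution_tendsto_right_of_continuous (μ := μ) hφ
    (continuous_translates (hv2.toLp v)) 0
  rw [translates_zero] at h
  refine h.congr fun i => Lp.ext ?_
  exact (convolution_translates_ae_eq (φ i).integrable_normed hv hv2).trans
    (hφv i).coeFn_toLp.symm

end Mollification

/-! ### Vector algebra and the classical curl -/

theorem inner_eq_sum (a b : R3) : ⟪a, b⟫ = a 0 * b 0 + a 1 * b 1 + a 2 * b 2 := by
  simp [PiLp.inner_apply, Fin.sum_univ_three, mul_comm]

theorem inner_cross_self_right (a b : R3) : ⟪cross a b, b⟫ = 0 := by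
  simp only [inner_eq_sum, cross, cross_apply, Matrix.cons_val]
  ring

theorem inner_cross_cross_self (a b : R3) : ⟪cross (cross a b) b, a⟫ = -‖cross a b‖ ^ 2 := by
  simp only [← real_inner_self_eq_norm_sq, inner_eq_sum, cross, cross_apply, Matrix.cons_val]
  ring

theorem norm_cross_sq (a b : R3) : ‖cross a b‖ ^ 2 = ‖a‖ ^ 2 * ‖b‖ ^ 2 - ⟪a, b⟫ ^ 2 := by
  simp only [← real_inner_self_eq_norm_sq, inner_eq_sum, cross, cross_apply, Matrix.cons_val]
  ring

theorem norm_cross_le (a b : R3) : ‖cross a b‖ ≤ ‖a‖ * ‖b‖ := by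
  refine abs_le_of_sq_le_sq' ?_ (by positivity) |>.2
  rw [norm_cross_sq, mul_pow]
  linarith [sq_nonneg ⟪a, b⟫]

/-- Twice the axial vector of the antisymmetric part of a linear map; the curl of a field is the
axial vector of its derivative. -/
def axialVector : (R3 →L[ℝ] R3) →L[ℝ] R3 :=
  LinearMap.toContinuousLinearMap
    { toFun A := !₂[A (.single 1 1) 2 - A (.single 2 1) 1, A (.single 2 1) 0 - A (.single 0 1) 2,
        A (.single 0 1) 1 - A (.single 1 1) 0]
      map_add' A B := by ext i; fin_cases i <;> simp <;> ring
      map_smul' c A := by ext i; fin_cases i <;> simp <;> ring }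

theorem axialVector_apply (A : R3 →L[ℝ] R3) :
    axialVector A = !₂[A (.single 1 1) 2 - A (.single 2 1) 1,
      A (.single 2 1) 0 - A (.single 0 1) 2, A (.single 0 1) 1 - A (.single 1 1) 0] := rfl

theorem cCurl_eq_axialVector (φ : R3 → R3) (x : R3) : cCurl φ x = axialVector (fderiv ℝ φ x) := rfl

theorem inner_axialVector_cross (A : R3 →L[ℝ] R3) (a b : R3) :
    ⟪axialVector A, cross a b⟫ = ⟪b, A a⟫ - ⟪a, A b⟫ := by
  have apply_eq (c : R3) :
      A c = c 0 • A (.single 0 1) + c 1 • A (.single 1 1) + c 2 • A (.single 2 1) := by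
    simp only [← map_smul, ← map_add]
    congr 1
    ext i
    fin_cases i <;> simp
  rw [apply_eq a, apply_eq b]
  simp only [axialVector_apply, inner_eq_sum, cross, cross_apply, Matrix.cons_val, PiLp.add_apply,
    PiLp.smul_apply, smul_eq_mul]
  ring

theorem axialVector_eq_zero_of_isSymmetric {A : R3 →L[ℝ] R3} (hA : A.IsSymmetric) :
    axialVector A = 0 := by
  have swap (i k : Fin 3) : A (.single i 1) k = A (.single k 1) i := by
    simpa [EuclideanSpace.inner_single_left, EuclideanSpace.inner_single_right] using
      hA (.single i 1) (.single k 1)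
  ext i
  fin_cases i <;> simp [axialVector_apply, swap 1 2, swap 2 0, swap 0 1]

theorem inner_axialVector_smulRight (ℓ : R3 →L[ℝ] ℝ) (a b : R3) :
    ⟪axialVector (ℓ.smulRight a), b⟫ = -⟪a, axialVector (ℓ.smulRight b)⟫ := by
  simp only [axialVector_apply, inner_eq_sum, smulRight_apply, Matrix.cons_val, PiLp.smul_apply,
    smul_eq_mul]
  ring

theorem IsSmoothCpt.comp_add_right {F : Type*} [NormedAddCommGroup F] [NormedSpace ℝ F]
    {φ : R3 → F} (hφ : IsSmoothCpt φ) (y : R3) : IsSmoothCpt fun x => φ (x + y) :=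
  ⟨hφ.1.comp (contDiff_id.add contDiff_const), hφ.2.comp_homeomorph (Homeomorph.addRight y)⟩

theorem IsSmoothCpt.contDiff_fderiv {F : Type*} [NormedAddCommGroup F] [NormedSpace ℝ F]
    {φ : R3 → F} (hφ : IsSmoothCpt φ) : ContDiff ℝ ∞ (fderiv ℝ φ) :=
  hφ.1.fderiv_right (by simp)

theorem IsSmoothCpt.memLp {F : Type*} [NormedAddCommGroup F] [NormedSpace ℝ F]
    {φ : R3 → F} (hφ : IsSmoothCpt φ) : MemLp φ 2 volume :=
  hφ.1.continuous.memLp_of_hasCompactSupport hφ.2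

theorem IsSmoothCpt.cCurl {φ : R3 → R3} (hφ : IsSmoothCpt φ) : IsSmoothCpt (cCurl φ) :=
  ⟨axialVector.contDiff.comp hφ.contDiff_fderiv,
    (hφ.2.fderiv ℝ).comp_left (g := axialVector) (map_zero _)⟩

theorem IsSmoothCpt.gradient {χ : R3 → ℝ} (hχ : IsSmoothCpt χ) : IsSmoothCpt (gradient χ) :=
  ⟨(InnerProductSpace.toDual ℝ R3).symm.contDiff.comp hχ.contDiff_fderiv,
    (hχ.2.fderiv ℝ).comp_left (g := (InnerProductSpace.toDual ℝ R3).symm) (map_zero _)⟩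

theorem cCurl_gradient {χ : R3 → ℝ} (hχ : ContDiff ℝ 2 χ) (x : R3) :
    cCurl (gradient χ) x = 0 := by
  have hderiv : fderiv ℝ (gradient χ) x =
      (InnerProductSpace.toDual ℝ R3).symm.toContinuousLinearEquiv.toContinuousLinearMap.comp
        (fderiv ℝ (fderiv ℝ χ) x) :=
    (InnerProductSpace.toDual ℝ R3).symm.toContinuousLinearEquiv.comp_fderiv
  rw [cCurl_eq_axialVector, hderiv]
  refine axialVector_eq_zero_of_isSymmetric fun a b => ?_
  have hsymm : IsSymmSndFDerivAt ℝ χ x :=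
    hχ.contDiffAt.isSymmSndFDerivAt minSmoothness_of_isRCLikeNormedField.le
  change ⟪(InnerProductSpace.toDual ℝ R3).symm _, b⟫ =
    ⟪a, (InnerProductSpace.toDual ℝ R3).symm _⟫
  rw [real_inner_comm _ a, InnerProductSpace.toDual_symm_apply, InnerProductSpace.toDual_symm_apply]
  exact hsymm.eq a b

/-! ### Pairing a solenoidal field with a smooth field -/

theorem integral_inner_eq_inner_toLp {α F : Type*} [MeasurableSpace α] {μ : Measure α}
    [NormedAddCommGroup F] [InnerProductSpace ℝ F] {v w : α → F} (hv : MemLp v 2 μ)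
    (hw : MemLp w 2 μ) : ∫ x, ⟪v x, w x⟫ ∂μ = ⟪hv.toLp v, hw.toLp w⟫ := by
  rw [L2.inner_def]
  refine integral_congr_ae ?_
  filter_upwards [hv.coeFn_toLp, hw.coeFn_toLp] with x hvx hwx
  rw [hvx, hwx]

theorem abs_integral_inner_le {α F : Type*} [MeasurableSpace α] {μ : Measure α}
    [NormedAddCommGroup F] [InnerProductSpace ℝ F] {v w : α → F} (hv : MemLp v 2 μ)
    (hw : MemLp w 2 μ) : |∫ x, ⟪v x, w x⟫ ∂μ| ≤ ‖hv.toLp v‖ * ‖hw.toLp w‖ := by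
  rw [integral_inner_eq_inner_toLp hv hw]
  exact abs_real_inner_le_norm _ _

theorem integrable_inner_of_memLp {α F : Type*} [MeasurableSpace α] {μ : Measure α}
    [NormedAddCommGroup F] [InnerProductSpace ℝ F] {v w : α → F} (hv : MemLp v 2 μ)
    (hw : MemLp w 2 μ) : Integrable (fun x => ⟪v x, w x⟫) μ := by
  refine (L2.integrable_inner (𝕜 := ℝ) (hv.toLp v) (hw.toLp w)).congr ?_
  filter_upwards [hv.coeFn_toLp, hw.coeFn_toLp] with x hvx hwx
  rw [hvx, hwx]

theorem norm_toLp_comp_add_right {ψ : R3 → R3} (hψ : MemLp ψ 2 volume) (y : R3)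
    (hψy : MemLp (fun x => ψ (x + y)) 2 volume) : ‖hψy.toLp‖ = ‖hψ.toLp‖ := by
  rw [Lp.norm_toLp, Lp.norm_toLp]
  exact congrArg _
    (eLpNorm_comp_measurePreserving hψ.1 (measurePreserving_add_right volume y))

/-- A field on `ℝ³` whose weak divergence vanishes. -/
def IsSolenoidal (w : R3 → R3) : Prop :=
  ∀ χ : R3 → ℝ, IsSmoothCpt χ → ∫ x, ⟪w x, gradient χ x⟫ = 0

theorem IsSmoothCpt.fderiv_apply {F : Type*} [NormedAddCommGroup F] [NormedSpace ℝ F]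
    {φ : R3 → F} (hφ : IsSmoothCpt φ) (e : R3) : IsSmoothCpt fun x => fderiv ℝ φ x e :=
  ⟨hφ.contDiff_fderiv.clm_apply contDiff_const,
    (hφ.2.fderiv ℝ).comp_left (g := fun A : R3 →L[ℝ] F => A e) rfl⟩

theorem IsSmoothCpt.clm_comp {F F' : Type*} [NormedAddCommGroup F] [NormedSpace ℝ F]
    [NormedAddCommGroup F'] [NormedSpace ℝ F'] {φ : R3 → F} (hφ : IsSmoothCpt φ) (L : F →L[ℝ] F') :
    IsSmoothCpt fun x => L (φ x) :=
  ⟨L.contDiff.comp hφ.1, hφ.2.comp_left (map_zero L)⟩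

theorem inner_cCurl_cross {φ : R3 → R3} (hφ : Differentiable ℝ φ) (x a b : R3) :
    ⟪cCurl φ x, cross a b⟫ =
      ⟪b, fderiv ℝ φ x a⟫ - ⟪b, gradient (fun y => ⟪a, φ y⟫) x⟫ := by
  have hgrad : ⟪b, gradient (fun y => ⟪a, φ y⟫) x⟫ = ⟪a, fderiv ℝ φ x b⟫ := by
    rw [gradient, real_inner_comm, InnerProductSpace.toDual_symm_apply]
    exact congrArg (· b) ((innerSL ℝ a).hasFDerivAt.comp x (hφ x).hasFDerivAt).fderiv
  rw [hgrad, cCurl_eq_axialVector, inner_axialVector_cross]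

theorem continuous_cross_right (a : R3) : Continuous (cross a) :=
  ((WithLp.linearEquiv 2 ℝ (Fin 3 → ℝ)).symm.toLinearMap ∘ₗ crossProduct a.ofLp ∘ₗ
    (WithLp.linearEquiv 2 ℝ (Fin 3 → ℝ)).toLinearMap).continuous_of_finiteDimensional

theorem memLp_cross {w : R3 → R3} (hw : MemLp w 2 volume) (e : R3) :
    MemLp (fun x => cross e (w x)) 2 volume :=
  hw.of_le_mul ((continuous_cross_right e).comp_aestronglyMeasurable hw.1)
    (.of_forall fun x => norm_cross_le e (w x))

theorem norm_toLp_cross_le {w : R3 → R3} (hw : MemLp w 2 volume) (e : R3) :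
    ‖(memLp_cross hw e).toLp‖ ≤ ‖e‖ * ‖hw.toLp w‖ := by
  refine Lp.norm_le_mul_norm_of_ae_le_mul ?_
  filter_upwards [(memLp_cross hw e).coeFn_toLp, hw.coeFn_toLp] with x hx hwx
  rw [hx, hwx]
  exact norm_cross_le e (w x)

theorem IsSolenoidal.abs_integral_inner_fderiv_le {w : R3 → R3} (h : IsSolenoidal w)
    (hw : MemLp w 2 volume) {φ : R3 → R3} (hφ : IsSmoothCpt φ) (e : R3) :
    |∫ x, ⟪w x, fderiv ℝ φ x e⟫| ≤ ‖hφ.cCurl.memLp.toLp‖ * (‖e‖ * ‖hw.toLp w‖) := by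
  have hφe : IsSmoothCpt fun y => ⟪e, φ y⟫ := hφ.clm_comp (innerSL ℝ e)
  have hcurl : ∫ x, ⟪w x, fderiv ℝ φ x e⟫ = ∫ x, ⟪cCurl φ x, cross e (w x)⟫ := by
    simp only [inner_cCurl_cross (hφ.1.differentiable (by simp))]
    rw [integral_sub (integrable_inner_of_memLp hw (hφ.fderiv_apply e).memLp)
      (integrable_inner_of_memLp hw hφe.gradient.memLp), h _ hφe, sub_zero]
  rw [hcurl]
  exact (abs_integral_inner_le hφ.cCurl.memLp (memLp_cross hw e)).trans
    (by gcongr; exact norm_toLp_cross_le hw e)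

theorem hasDerivAt_integral_inner_translate {φ : R3 → R3} (hφ : IsSmoothCpt φ) {w : R3 → R3}
    (hw : Integrable w) (e : R3) (s : ℝ) :
    HasDerivAt (fun s : ℝ => ∫ x, ⟪w x, φ (x + s • e)⟫)
      (∫ x, ⟪w x, fderiv ℝ φ (x + s • e) e⟫) s := by
  have hbdd {ψ : R3 → R3} (hψ : IsSmoothCpt ψ) (s : ℝ) :
      Integrable fun x => ⟪w x, ψ (x + s • e)⟫ := by
    obtain ⟨M, hM⟩ := hψ.2.exists_bound_of_continuous hψ.1.continuous
    refine (hw.norm.mul_const M).mono'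
      (hw.1.inner (hψ.comp_add_right _).1.continuous.aestronglyMeasurable) (.of_forall fun x => ?_)
    exact (norm_inner_le_norm _ _).trans (by gcongr; exact hM _)
  obtain ⟨M, hM⟩ := (hφ.fderiv_apply e).2.exists_bound_of_continuous
    (hφ.fderiv_apply e).1.continuous
  refine (hasDerivAt_integral_of_dominated_loc_of_deriv_le (bound := fun x => ‖w x‖ * M)
    (F' := fun s x => ⟪w x, fderiv ℝ φ (x + s • e) e⟫)
    univ_mem (.of_forall fun s => (hbdd hφ s).1) (hbdd hφ s) (hbdd (hφ.fderiv_apply e) s).1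
    (.of_forall fun x s _ => (norm_inner_le_norm _ _).trans (by gcongr; exact hM _))
    (hw.norm.mul_const _) (.of_forall fun x s _ => ?_)).2
  have hline : HasDerivAt (fun s : ℝ => x + s • e) e s := by
    simpa using ((hasDerivAt_id s).smul_const e).const_add x
  have hφline := (hφ.1.differentiable (by simp) (x + s • e)).hasFDerivAt.comp_hasDerivAt s hline
  exact ((hasDerivAt_const s (w x)).inner ℝ hφline).congr_deriv (by simp)

theorem IsSolenoidal.abs_integral_inner_le_curl {w : R3 → R3} (h : IsSolenoidal w)
    (hw : MemLp w 2 volume) (hwi : Integrable w) {r R : ℝ} (hr : 0 ≤ r + R)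
    (hwR : Function.support w ⊆ Metric.closedBall 0 R) {φ : R3 → R3} (hφ : IsSmoothCpt φ)
    (hφr : Function.support φ ⊆ Metric.ball 0 r) :
    |∫ x, ⟪w x, φ x⟫| ≤ (r + R) * (‖hw.toLp w‖ * ‖hφ.cCurl.memLp.toLp‖) := by
  let e : R3 := .single 0 1
  have he : ‖e‖ = 1 := by simp [e]
  let f : ℝ → ℝ := fun s => ∫ x, ⟪w x, φ (x + s • e)⟫
  have hderiv (s : ℝ) : |∫ x, ⟪w x, fderiv ℝ φ (x + s • e) e⟫| ≤
      ‖hw.toLp w‖ * ‖hφ.cCurl.memLp.toLp‖ := by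
    have hφs := hφ.comp_add_right (s • e)
    have hcurl : cCurl (fun x => φ (x + s • e)) = fun x => cCurl φ (x + s • e) := by
      funext x
      simp only [cCurl_eq_axialVector, fderiv_comp_add_right]
    have hbound := h.abs_integral_inner_fderiv_le hw hφs e
    simp only [fderiv_comp_add_right, hcurl, he, one_mul] at hbound
    rwa [norm_toLp_comp_add_right hφ.cCurl.memLp, mul_comm] at hbound
  have hfar : f (r + R) = 0 := by
    refine integral_eq_zero_of_ae (.of_forall fun x => ?_)
    by_contra hne
    have hx : ‖x‖ ≤ R := by simpa using hwR fun h0 => hne (by simp [h0])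
    have hxe : ‖x + (r + R) • e‖ < r := by simpa using hφr fun h0 => hne (by simp [h0])
    have htriangle := norm_sub_le (x + (r + R) • e) x
    rw [add_sub_cancel_left, norm_smul, he, mul_one, Real.norm_of_nonneg hr] at htriangle
    linarith
  have hmean := Convex.norm_image_sub_le_of_norm_hasDerivWithin_le (f := f)
    (fun s _ => (hasDerivAt_integral_inner_translate hφ hwi e s).hasDerivWithinAt)
    (fun s _ => hderiv s) convex_univ (mem_univ (r + R)) (mem_univ 0)
  rw [hfar] at hmean
  rw [sub_zero, zero_sub, norm_neg, Real.norm_eq_abs, Real.norm_of_nonneg hr, mul_comm] at hmean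
  simpa [f] using hmean

/-! ### Fields with a curl on the whole space -/

/-- `w` is the weak curl of `v` on the whole of `ℝ³`. -/
def HasGlobalCurl (v w : R3 → R3) : Prop :=
  ∀ φ : R3 → R3, IsSmoothCpt φ → ∫ x, ⟪w x, φ x⟫ = ∫ x, ⟪v x, cCurl φ x⟫

theorem HasGlobalCurl.isSolenoidal {v w : R3 → R3} (h : HasGlobalCurl v w) : IsSolenoidal w := by
  intro χ hχ
  have hχ2 : ContDiff ℝ 2 χ := hχ.1.of_le (WithTop.coe_le_coe.2 le_top)
  rw [h _ hχ.gradient]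
  simp only [cCurl_gradient hχ2, inner_zero_right, integral_zero]

theorem cCurl_convolution {ρ : R3 → ℝ} (hρ : IsSmoothCpt ρ) {v : R3 → R3}
    (hv : LocallyIntegrable v) (x c : R3) :
    ⟪cCurl (ρ ⋆[lsmul ℝ ℝ, volume] v) x, c⟫ =
      ∫ t, ⟪v t, cCurl (fun t => ρ (x - t) • c) t⟫ := by
  have hρ1 : ContDiff ℝ 1 ρ := hρ.1.of_le (by simp)
  have hint : Integrable fun t => (fderiv ℝ ρ (x - t)).smulRight (v t) :=
    ((hρ.2.fderiv ℝ).convolutionExists_left ((lsmul ℝ ℝ).precompL R3)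
      hρ.contDiff_fderiv.continuous hv x).integrable_swap
  have hfderiv : fderiv ℝ (ρ ⋆[lsmul ℝ ℝ, volume] v) x =
      ∫ t, (fderiv ℝ ρ (x - t)).smulRight (v t) := by
    rw [(hρ.2.hasFDerivAt_convolution_left (lsmul ℝ ℝ) hρ1 hv x).fderiv, convolution_eq_swap]
    rfl
  have hcurl (t : R3) : cCurl (fun t => ρ (x - t) • c) t =
      -axialVector ((fderiv ℝ ρ (x - t)).smulRight c) := by
    have hρt : HasFDerivAt (fun t => ρ (x - t)) (-fderiv ℝ ρ (x - t)) t := by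
      simpa [Function.comp_def] using (hρ1.differentiable one_ne_zero (x - t)).hasFDerivAt.comp t
        ((hasFDerivAt_id t).const_sub x)
    have hsmul : (-fderiv ℝ ρ (x - t)).smulRight c = -(fderiv ℝ ρ (x - t)).smulRight c := by
      ext1 u
      simp
    rw [cCurl_eq_axialVector, (hρt.smul_const c).fderiv, hsmul, map_neg]
  rw [cCurl_eq_axialVector, hfderiv, ← integral_comp_comm _ hint, real_inner_comm,
    ← integral_inner (axialVector.integrable_comp hint)]
  refine integral_congr_ae (.of_forall fun t => ?_)
  simp only [hcurl, inner_neg_right]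
  rw [real_inner_comm, inner_axialVector_smulRight]

theorem HasGlobalCurl.cCurl_convolution {v w : R3 → R3} (h : HasGlobalCurl v w)
    (hv : LocallyIntegrable v) (hw : LocallyIntegrable w) {ρ : R3 → ℝ} (hρ : IsSmoothCpt ρ) :
    cCurl (ρ ⋆[lsmul ℝ ℝ, volume] v) = ρ ⋆[lsmul ℝ ℝ, volume] w := by
  funext x
  refine ext_inner_right ℝ fun c => ?_
  have hφ : IsSmoothCpt fun t => ρ (x - t) • c :=
    ⟨(hρ.1.comp (contDiff_const.sub contDiff_id)).smul contDiff_const,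
      (hρ.2.comp_homeomorph (Homeomorph.subLeft x)).smul_right⟩
  have hint : Integrable fun t => ρ (x - t) • w t :=
    (hρ.2.convolutionExists_left (lsmul ℝ ℝ) hρ.1.continuous hw x).integrable_swap
  calc ⟪cCurl (ρ ⋆[lsmul ℝ ℝ, volume] v) x, c⟫
      = ∫ t, ⟪w t, ρ (x - t) • c⟫ := by
        rw [MagnetoFriction.cCurl_convolution hρ hv, h _ hφ]
    _ = ⟪(ρ ⋆[lsmul ℝ ℝ, volume] w) x, c⟫ := by
        rw [convolution_eq_swap, real_inner_comm]
        simp only [lsmul_apply]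
        rw [← integral_inner hint]
        simp only [inner_smul_right, real_inner_comm c]

theorem integrable_of_support_subset_closedBall {F : Type*} [NormedAddCommGroup F] {R : ℝ}
    {v : R3 → F} (hv : MemLp v 2 volume) (hvR : Function.support v ⊆ Metric.closedBall 0 R) :
    Integrable v := by
  rw [← integrableOn_iff_integrable_of_support_subset hvR]
  have : IsFiniteMeasure (volume.restrict (Metric.closedBall (0 : R3) R)) :=
    isFiniteMeasure_restrict.2 measure_closedBall_lt_top.ne
  exact (hv.restrict _).integrable (by norm_num)

/-- A sequence of bump functions at the origin whose supports shrink to a point. -/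
def bump (n : ℕ) : ContDiffBump (0 : R3) where
  rIn := 1 / (2 * (n + 1))
  rOut := 1 / (n + 1)
  rIn_pos := by positivity
  rIn_lt_rOut := by gcongr; linarith [(n.cast_nonneg : (0 : ℝ) ≤ n)]

theorem rOut_bump_le_one (n : ℕ) : (bump n).rOut ≤ 1 :=
  div_le_one_of_le₀ (by simp) (by positivity)

theorem HasGlobalCurl.exists_smooth_approximation {v w : R3 → R3} (h : HasGlobalCurl v w)
    {R : ℝ} (hv : MemLp v 2 volume) (hw : MemLp w 2 volume)
    (hvR : Function.support v ⊆ Metric.closedBall 0 R)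
    (hwR : Function.support w ⊆ Metric.closedBall 0 R) :
    ∃ (φ : ℕ → R3 → R3) (hφ : ∀ n, IsSmoothCpt (φ n)),
      (∀ n, Function.support (φ n) ⊆ Metric.ball 0 (1 + R)) ∧
      Tendsto (fun n => (hφ n).memLp.toLp) atTop (𝓝 (hv.toLp v)) ∧
      Tendsto (fun n => (hφ n).cCurl.memLp.toLp) atTop (𝓝 (hw.toLp w)) := by
  have hvi := integrable_of_support_subset_closedBall hv hvR
  have hwi := integrable_of_support_subset_closedBall hw hwR
  have hbump (n : ℕ) : IsSmoothCpt ((bump n).normed volume) :=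
    ⟨(bump n).contDiff_normed, (bump n).hasCompactSupport_normed⟩
  let φ (n : ℕ) : R3 → R3 := (bump n).normed volume ⋆[lsmul ℝ ℝ, volume] v
  have hsupp (n : ℕ) : Function.support (φ n) ⊆ Metric.ball 0 (1 + R) := by
    refine (support_convolution_subset _).trans ?_
    rw [ContDiffBump.support_normed_eq]
    refine (Set.add_subset_add (Metric.ball_subset_ball (rOut_bump_le_one n)) hvR).trans ?_
    rcases lt_or_ge R 0 with hR | hR
    · simp [Metric.closedBall_eq_empty.2 hR]
    · rw [ball_add_closedBall one_pos hR, add_zero]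
  have hφ (n : ℕ) : IsSmoothCpt (φ n) :=
    ⟨(hbump n).2.contDiff_convolution_left (n := ⊤) _ (hbump n).1 hvi.locallyIntegrable,
      .of_support_subset_isCompact (isCompact_closedBall 0 (1 + R))
        ((hsupp n).trans Metric.ball_subset_closedBall)⟩
  have hcurl (n : ℕ) : cCurl (φ n) = (bump n).normed volume ⋆[lsmul ℝ ℝ, volume] w :=
    h.cCurl_convolution hvi.locallyIntegrable hwi.locallyIntegrable (hbump n)
  have hr : Tendsto (fun n => (bump n).rOut) atTop (𝓝 0) :=
    tendsto_one_div_add_atTop_nhds_zero_nat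
  refine ⟨φ, hφ, hsupp, tendsto_toLp_convolution hr hvi hv _, ?_⟩
  simp only [hcurl]
  exact tendsto_toLp_convolution hr hwi hw _

theorem HasGlobalCurl.integral_inner_comm {v w z q : R3 → R3} (h : HasGlobalCurl v w)
    (h' : HasGlobalCurl z q) {R : ℝ} (hv : MemLp v 2 volume) (hw : MemLp w 2 volume)
    (hz : MemLp z 2 volume) (hq : MemLp q 2 volume)
    (hvR : Function.support v ⊆ Metric.closedBall 0 R)
    (hwR : Function.support w ⊆ Metric.closedBall 0 R) :
    ∫ x, ⟪q x, v x⟫ = ∫ x, ⟪z x, w x⟫ := by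
  obtain ⟨φ, hφ, -, hφv, hφw⟩ := h.exists_smooth_approximation hv hw hvR hwR
  rw [integral_inner_eq_inner_toLp hq hv, integral_inner_eq_inner_toLp hz hw]
  refine tendsto_nhds_unique (tendsto_const_nhds.inner hφv) ?_
  refine (tendsto_const_nhds.inner hφw).congr fun n => ?_
  rw [← integral_inner_eq_inner_toLp hz, ← integral_inner_eq_inner_toLp hq, h' _ (hφ n)]

theorem HasGlobalCurl.abs_helicity_le {v w : R3 → R3} (h : HasGlobalCurl v w) {R : ℝ}
    (hR : 0 ≤ R) (hv : MemLp v 2 volume) (hw : MemLp w 2 volume)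
    (hvR : Function.support v ⊆ Metric.closedBall 0 R)
    (hwR : Function.support w ⊆ Metric.closedBall 0 R) :
    |∫ x, ⟪v x, w x⟫| ≤ (2 * R + 1) * ‖hw.toLp w‖ ^ 2 := by
  obtain ⟨φ, hφ, hsupp, hφv, hφw⟩ := h.exists_smooth_approximation hv hw hvR hwR
  have hwi := integrable_of_support_subset_closedBall hw hwR
  have hbound (n : ℕ) : |⟪hw.toLp w, (hφ n).memLp.toLp⟫| ≤
      (1 + R + R) * (‖hw.toLp w‖ * ‖(hφ n).cCurl.memLp.toLp‖) := by
    rw [← integral_inner_eq_inner_toLp]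
    exact h.isSolenoidal.abs_integral_inner_le_curl hw hwi (by linarith) hwR (hφ n) (hsupp n)
  have hlim := le_of_tendsto_of_tendsto' (tendsto_const_nhds.inner hφv).abs
    ((hφw.norm.const_mul ‖hw.toLp w‖).const_mul (1 + R + R)) hbound
  rw [integral_inner_eq_inner_toLp hv hw, real_inner_comm]
  linarith

/-! ### Extension by zero -/

theorem memLp_indicator {Ω : Set R3} (hΩ : MeasurableSet Ω) (v : L2V Ω) :
    MemLp (Ω.indicator v) 2 volume :=
  (memLp_indicator_iff_restrict hΩ).2 (Lp.memLp v)

theorem integral_inner_indicator {Ω : Set R3} (hΩ : MeasurableSet Ω) (v φ : R3 → R3) :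
    ∫ x, ⟪Ω.indicator v x, φ x⟫ = ∫ x in Ω, ⟪v x, φ x⟫ := by
  rw [← integral_indicator hΩ]
  congr 1 with x
  by_cases hx : x ∈ Ω <;> simp [hx]

theorem integral_inner_indicator_indicator {Ω : Set R3} (hΩ : MeasurableSet Ω) (v w : L2V Ω) :
    ∫ x, ⟪Ω.indicator v x, Ω.indicator w x⟫ = ⟪v, w⟫ := by
  rw [integral_inner_indicator hΩ, L2.inner_def]
  exact setIntegral_congr_fun hΩ fun x hx => by simp only [indicator_of_mem hx]

theorem norm_toLp_indicator {Ω : Set R3} (hΩ : MeasurableSet Ω) (v : L2V Ω) :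
    ‖(memLp_indicator hΩ v).toLp‖ = ‖v‖ := by
  rw [Lp.norm_toLp, Lp.norm_def, eLpNorm_indicator_eq_eLpNorm_restrict hΩ]

theorem MemHCurl.hasWeakCurl_wCurl {Ω : Set R3} {v : L2V Ω} (h : MemHCurl Ω v) :
    HasWeakCurl Ω v (wCurl Ω v) := by
  rw [wCurl, dif_pos h]
  exact h.choose_spec

theorem MemHDiv.hasWeakDiv_wDiv {Ω : Set R3} {v : L2V Ω} (h : MemHDiv Ω v) :
    HasWeakDiv Ω v (wDiv Ω v) := by
  rw [wDiv, dif_pos h]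
  exact h.choose_spec

theorem MemH0Curl.hasGlobalCurl {Ω : Set R3} (hΩ : MeasurableSet Ω) {v : L2V Ω}
    (h : MemH0Curl Ω v) : HasGlobalCurl (Ω.indicator v) (Ω.indicator (wCurl Ω v)) := by
  intro φ hφ
  rw [integral_inner_indicator hΩ, integral_inner_indicator hΩ]
  exact sub_eq_zero.1 (h.2 φ hφ)

theorem MemH0Curl.inner_wCurl_comm {Ω : Set R3} (hΩ : MeasurableSet Ω)
    (hb : Bornology.IsBounded Ω) {v z : L2V Ω} (hv : MemH0Curl Ω v) (hz : MemH0Curl Ω z) :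
    ⟪wCurl Ω z, v⟫ = ⟪z, wCurl Ω v⟫ := by
  obtain ⟨R, hR⟩ := hb.subset_closedBall 0
  rw [← integral_inner_indicator_indicator hΩ, ← integral_inner_indicator_indicator hΩ]
  exact (hv.hasGlobalCurl hΩ).integral_inner_comm (hz.hasGlobalCurl hΩ) (memLp_indicator hΩ _)
    (memLp_indicator hΩ _) (memLp_indicator hΩ _) (memLp_indicator hΩ _)
    (support_indicator_subset.trans hR) (support_indicator_subset.trans hR)

theorem exists_forall_mul_abs_inner_wCurl_le {Ω : Set R3} (hΩ : MeasurableSet Ω)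
    (hb : Bornology.IsBounded Ω) :
    ∃ C : ℝ, 0 < C ∧ ∀ v : L2V Ω, MemH0Curl Ω v → C * |⟪v, wCurl Ω v⟫| ≤ ‖wCurl Ω v‖ ^ 2 := by
  obtain ⟨R, hR, hΩR⟩ := hb.subset_closedBall_lt 0 0
  refine ⟨(2 * R + 1)⁻¹, by positivity, fun v hv => ?_⟩
  have h := (hv.hasGlobalCurl hΩ).abs_helicity_le hR.le (memLp_indicator hΩ _)
    (memLp_indicator hΩ _) (support_indicator_subset.trans hΩR)
    (support_indicator_subset.trans hΩR)
  rw [integral_inner_indicator_indicator hΩ, norm_toLp_indicator hΩ] at h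
  rwa [inv_mul_le_iff₀ (by positivity)]

/-! ### Uniqueness of the weak derivatives -/

theorem integral_inner_eq_inner {α F : Type*} [MeasurableSpace α] {μ : Measure α}
    [NormedAddCommGroup F] [InnerProductSpace ℝ F] (v : Lp F 2 μ) {φ : α → F} (hφ : MemLp φ 2 μ) :
    ∫ x, ⟪v x, φ x⟫ ∂μ = ⟪v, hφ.toLp⟫ := by
  rw [integral_inner_eq_inner_toLp (Lp.memLp v) hφ, Lp.toLp_coeFn]

theorem IsTest.gradient {Ω : Set R3} {χ : R3 → ℝ} (hχ : IsTest Ω χ) : IsTest Ω (gradient χ) :=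
  ⟨hχ.1.gradient, ((tsupport_comp_subset (g := (InnerProductSpace.toDual ℝ R3).symm)
    (map_zero _) _).trans (tsupport_fderiv_subset ℝ)).trans hχ.2⟩

theorem eq_zero_of_forall_test {Ω : Set R3} (hΩ : IsOpen Ω) {F : Type*} [NormedAddCommGroup F]
    [InnerProductSpace ℝ F] [CompleteSpace F] {v : Lp F 2 (volume.restrict Ω)}
    (h : ∀ φ : R3 → F, IsTest Ω φ → ∫ x in Ω, ⟪v x, φ x⟫ = 0) : v = 0 := by
  have hloc : LocallyIntegrable v (volume.restrict Ω) :=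
    (Lp.memLp v).locallyIntegrable (by norm_num)
  refine (Lp.eq_zero_iff_ae_eq_zero).2 <| (ae_restrict_iff' hΩ.measurableSet).2 <|
    hΩ.ae_eq_zero_of_integral_contDiff_smul_eq_zero
      (locallyIntegrableOn_of_locallyIntegrable_restrict hloc) fun g hg hgc hgΩ => ?_
  have hout (x : R3) (hx : x ∉ Ω) : g x • v x = 0 := by
    rw [image_eq_zero_of_notMem_tsupport fun hx' => hx (hgΩ hx'), zero_smul]
  have hint : Integrable (fun x => g x • v x) (volume.restrict Ω) :=
    memLp_one_iff_integrable.1 ((Lp.memLp v).smul (p := 2) (q := 2) (r := 1)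
      ((IsSmoothCpt.memLp ⟨hg, hgc⟩).restrict Ω))
  rw [← setIntegral_eq_integral_of_forall_compl_eq_zero hout]
  refine ext_inner_left ℝ fun c => ?_
  rw [← integral_inner hint c, inner_zero_right,
    ← h (fun x => g x • c) ⟨⟨hg.smul contDiff_const, hgc.smul_right⟩,
      (tsupport_smul_subset_left g _).trans hgΩ⟩]
  simp only [inner_smul_right, real_inner_comm]

theorem eq_of_forall_test {Ω : Set R3} (hΩ : IsOpen Ω) {F : Type*} [NormedAddCommGroup F]
    [InnerProductSpace ℝ F] [CompleteSpace F] {v w : Lp F 2 (volume.restrict Ω)}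
    (h : ∀ φ : R3 → F, IsTest Ω φ → ∫ x in Ω, ⟪v x, φ x⟫ = ∫ x in Ω, ⟪w x, φ x⟫) : v = w := by
  refine sub_eq_zero.1 (eq_zero_of_forall_test hΩ fun φ hφ => ?_)
  have hφΩ : MemLp φ 2 (volume.restrict Ω) := hφ.1.memLp.restrict Ω
  rw [integral_inner_eq_inner _ hφΩ, inner_sub_left, sub_eq_zero,
    ← integral_inner_eq_inner, ← integral_inner_eq_inner, h φ hφ]

theorem HasWeakCurl.wCurl_eq {Ω : Set R3} (hΩ : IsOpen Ω) {v w : L2V Ω}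
    (h : HasWeakCurl Ω v w) : wCurl Ω v = w :=
  eq_of_forall_test hΩ fun φ hφ =>
    (MemHCurl.hasWeakCurl_wCurl ⟨w, h⟩ φ hφ).trans (h φ hφ).symm

theorem HasWeakDiv.wDiv_eq {Ω : Set R3} (hΩ : IsOpen Ω) {v : L2V Ω} {d : L2S Ω}
    (h : HasWeakDiv Ω v d) : wDiv Ω v = d :=
  eq_of_forall_test hΩ fun φ hφ => by
    simpa [mul_comm (φ _)] using (MemHDiv.hasWeakDiv_wDiv ⟨d, h⟩ φ hφ).trans (h φ hφ).symm

theorem HasWeakCurl.integral_inner_gradient {Ω : Set R3} {v w : L2V Ω} (h : HasWeakCurl Ω v w)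
    {χ : R3 → ℝ} (hχ : IsTest Ω χ) : ∫ x in Ω, ⟪w x, gradient χ x⟫ = 0 := by
  have hχ2 : ContDiff ℝ 2 χ := hχ.1.1.of_le (WithTop.coe_le_coe.2 le_top)
  rw [h _ hχ.gradient]
  simp only [cCurl_gradient hχ2, inner_zero_right, integral_zero]

theorem HasWeakCurl.neg {Ω : Set R3} {v w : L2V Ω} (h : HasWeakCurl Ω v w) :
    HasWeakCurl Ω (-v) (-w) := by
  intro φ hφ
  have hφΩ : MemLp φ 2 (volume.restrict Ω) := hφ.1.memLp.restrict Ω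
  have hcurlΩ : MemLp (cCurl φ) 2 (volume.restrict Ω) := hφ.1.cCurl.memLp.restrict Ω
  rw [integral_inner_eq_inner _ hφΩ, integral_inner_eq_inner _ hcurlΩ, inner_neg_left,
    inner_neg_left, ← integral_inner_eq_inner, ← integral_inner_eq_inner, h φ hφ]

/-! ### The semi-discrete scheme -/

theorem eq_of_hasDerivWithinAt_zero {F : Type*} [NormedAddCommGroup F] [NormedSpace ℝ F]
    {f : ℝ → F} (hf : ∀ t, 0 ≤ t → HasDerivWithinAt f 0 (Ici 0) t) {t : ℝ} (ht : 0 ≤ t) :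
    f t = f 0 := by
  have h := (convex_Ici (0 : ℝ)).norm_image_sub_le_of_norm_hasDerivWithin_le (C := 0)
    (fun s hs => hf s hs) (fun s _ => norm_zero.le) self_mem_Ici (mem_Ici.2 ht)
  rw [zero_mul] at h
  exact sub_eq_zero.1 (norm_le_zero_iff.1 h)

theorem exists_hasDerivWithinAt_of_continuousOn_Ici {F : Type*} [NormedAddCommGroup F]
    [NormedSpace ℝ F] [CompleteSpace F] {f : ℝ → F} (hf : ContinuousOn f (Ici 0)) (a : F) :
    ∃ g : ℝ → F, g 0 = a ∧ ∀ t, 0 ≤ t → HasDerivWithinAt g (f t) (Ici 0) t := by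
  have hcont : Continuous fun s => f (max s 0) :=
    hf.comp_continuous (by fun_prop) fun s => le_max_right s 0
  refine ⟨fun t => a + ∫ s in (0 : ℝ)..t, f (max s 0), by simp, fun t ht => ?_⟩
  have hderiv := ((hcont.integral_hasStrictDerivAt 0 t).hasDerivAt.const_add a).hasDerivWithinAt
    (s := Ici 0)
  rwa [max_eq_left ht] at hderiv

theorem HasWeakCurl.of_hasDerivWithinAt {Ω : Set R3} {A B A' B' : ℝ → L2V Ω}
    (hA : ∀ t, 0 ≤ t → HasDerivWithinAt A (A' t) (Ici 0) t)
    (hB : ∀ t, 0 ≤ t → HasDerivWithinAt B (B' t) (Ici 0) t)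
    (h' : ∀ t, 0 ≤ t → HasWeakCurl Ω (A' t) (B' t)) (h0 : HasWeakCurl Ω (A 0) (B 0)) {t : ℝ}
    (ht : 0 ≤ t) : HasWeakCurl Ω (A t) (B t) := by
  intro φ hφ
  have hφΩ : MemLp φ 2 (volume.restrict Ω) := hφ.1.memLp.restrict Ω
  have hcurlΩ : MemLp (cCurl φ) 2 (volume.restrict Ω) := hφ.1.cCurl.memLp.restrict Ω
  have pairing {v w : L2V Ω} (h : HasWeakCurl Ω v w) : ⟪w, hφΩ.toLp⟫ - ⟪v, hcurlΩ.toLp⟫ = 0 := by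
    rw [← integral_inner_eq_inner, ← integral_inner_eq_inner, h φ hφ, sub_self]
  have hconst := eq_of_hasDerivWithinAt_zero
    (f := fun s => ⟪B s, hφΩ.toLp⟫ - ⟪A s, hcurlΩ.toLp⟫) (fun s hs =>
      (((hB s hs).inner ℝ (hasDerivWithinAt_const s _ _)).sub
        ((hA s hs).inner ℝ (hasDerivWithinAt_const s _ _))).congr_deriv
        (by simpa only [inner_zero_right, zero_add] using pairing (h' s hs))) ht
  rw [integral_inner_eq_inner _ hφΩ, integral_inner_eq_inner _ hcurlΩ, ← sub_eq_zero]
  exact hconst.trans (pairing h0)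

theorem IsPotential.inner_eq {Ω : Set R3} (hΩ : MeasurableSet Ω) (hb : Bornology.IsBounded Ω)
    {X : DiscreteComplex Ω} {b A A' : L2V Ω} (hA : IsPotential X b A) (hA' : IsPotential X b A') :
    ⟪A, b⟫ = ⟪A', b⟫ := by
  have hsymm := (X.mem1 _ hA.1).inner_wCurl_comm hΩ hb (X.mem1 _ hA'.1)
  rw [hA.2, hA'.2] at hsymm
  rw [← hsymm, real_inner_comm]

theorem IsPotential.hasWeakCurl {Ω : Set R3} {X : DiscreteComplex Ω} {b A : L2V Ω}
    (hA : IsPotential X b A) : HasWeakCurl Ω A b :=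
  hA.2 ▸ (X.mem1 A hA.1).1.hasWeakCurl_wCurl

theorem IsPotential.wDiv_eq_zero {Ω : Set R3} (hΩ : IsOpen Ω) {X : DiscreteComplex Ω}
    {b A : L2V Ω} (hA : IsPotential X b A) : wDiv Ω b = 0 := by
  refine HasWeakDiv.wDiv_eq hΩ fun χ hχ => ?_
  rw [hA.hasWeakCurl.integral_inner_gradient hχ, neg_zero]
  refine integral_eq_zero_of_ae ?_
  filter_upwards [Lp.coeFn_zero ℝ 2 (volume.restrict Ω)] with x hx
  rw [hx, Pi.zero_apply, zero_mul]

namespace IsSolution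

variable {Ω : Set R3} {X : DiscreteComplex Ω} {τ : ℝ} {B₀ : X.V2} {B : ℝ → X.V2}
  {E j H : ℝ → X.V1} {t : ℝ}

theorem timeDeriv_add_wCurl (h : IsSolution X τ B₀ B E j H) (ht : 0 ≤ t) :
    (timeDeriv B t : L2V Ω) + wCurl Ω (E t) = 0 := by
  have hmem : (timeDeriv B t : L2V Ω) + wCurl Ω (E t) ∈ X.V2 :=
    X.V2.add_mem (timeDeriv B t).2 (X.curl_mem _ (E t).2)
  rw [← inner_self_eq_zero (𝕜 := ℝ), inner_add_left]
  exact h.advection t ht _ hmem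

theorem hasDerivWithinAt_B (h : IsSolution X τ B₀ B E j H) (ht : 0 ≤ t) :
    HasDerivWithinAt (fun s => (B s : L2V Ω)) (-wCurl Ω (E t)) (Ici 0) t := by
  have hB : HasDerivWithinAt B (timeDeriv B t) (Ici 0) t :=
    (h.contDiffOn_B.differentiableOn one_ne_zero t ht).hasDerivWithinAt
  rw [← eq_neg_of_add_eq_zero_left (h.timeDeriv_add_wCurl ht)]
  exact X.V2.subtypeL.hasFDerivAt.comp_hasDerivWithinAt t hB

theorem wDiv_eq (hΩ : IsOpen Ω) (h : IsSolution X τ B₀ B E j H) (ht : 0 ≤ t) :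
    wDiv Ω (B t) = wDiv Ω B₀ := by
  refine HasWeakDiv.wDiv_eq hΩ fun χ hχ => ?_
  have hχ2 : MemLp (gradient χ) 2 (volume.restrict Ω) := hχ.1.gradient.memLp.restrict Ω
  have hconst : ⟪(B t : L2V Ω), hχ2.toLp⟫ = ⟪(B 0 : L2V Ω), hχ2.toLp⟫ := by
    refine eq_of_hasDerivWithinAt_zero (f := fun s => ⟪(B s : L2V Ω), hχ2.toLp⟫)
      (fun s hs => ?_) ht
    refine ((h.hasDerivWithinAt_B hs).inner ℝ (hasDerivWithinAt_const s _ _)).congr_deriv ?_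
    rw [inner_zero_right, zero_add, inner_neg_left, ← integral_inner_eq_inner,
      (X.mem1 _ (E s).2).1.hasWeakCurl_wCurl.integral_inner_gradient hχ, neg_zero]
  rw [(X.mem2 _ B₀.2).1.hasWeakDiv_wDiv χ hχ, integral_inner_eq_inner _ hχ2, ← h.initial, ← hconst,
    integral_inner_eq_inner]

theorem inner_B_wCurl_E (h : IsSolution X τ B₀ B E j H) (ht : 0 ≤ t) :
    ⟪(B t : L2V Ω), wCurl Ω (E t)⟫ = τ * crossNormSq (j t : L2V Ω) (H t) := by
  have hj := h.electric t ht _ (j t).2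
  simp only [inner_cross_cross_self, integral_neg] at hj
  rw [← h.current t ht _ (E t).2, real_inner_comm, crossNormSq]
  linarith

theorem inner_B_E (h : IsSolution X τ B₀ B E j H) (ht : 0 ≤ t) :
    ⟪(B t : L2V Ω), (E t : L2V Ω)⟫ = 0 := by
  rw [← h.magnetic t ht _ (E t).2, real_inner_comm]
  simpa only [inner_cross_self_right, integral_zero, mul_zero, add_zero] using
    h.electric t ht _ (H t).2

theorem continuousOn_crossNormSq (hτ : τ ≠ 0) (h : IsSolution X τ B₀ B E j H) :
    ContinuousOn (fun s => crossNormSq (j s : L2V Ω) (H s)) (Ici 0) := by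
  have hcont : ContinuousOn (fun s => τ⁻¹ * ⟪(j s : L2V Ω), (E s : L2V Ω)⟫) (Ici 0) :=
    continuousOn_const.mul (ContinuousOn.inner (𝕜 := ℝ)
      (continuous_subtype_val.comp_continuousOn h.continuousOn_j)
      (continuous_subtype_val.comp_continuousOn h.continuousOn_E))
  refine hcont.congr fun s hs => ?_
  beta_reduce
  rw [h.current s hs _ (E s).2, h.inner_B_wCurl_E hs, inv_mul_cancel_left₀ hτ]

theorem intervalIntegrable_crossNormSq (hτ : τ ≠ 0) (h : IsSolution X τ B₀ B E j H)
    (ht : 0 ≤ t) : IntervalIntegrable (fun s => crossNormSq (j s : L2V Ω) (H s)) volume 0 t :=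
  ((h.continuousOn_crossNormSq hτ).mono
    (by rw [uIcc_of_le ht]; exact Icc_subset_Ici_self)).intervalIntegrable

theorem norm_sq_sub_norm_sq (hτ : τ ≠ 0) (h : IsSolution X τ B₀ B E j H) (ht : 0 ≤ t) :
    ‖(B t : L2V Ω)‖ ^ 2 - ‖(B 0 : L2V Ω)‖ ^ 2 =
      -2 * τ * ∫ s in (0 : ℝ)..t, crossNormSq (j s : L2V Ω) (H s) := by
  have hderiv (s : ℝ) (hs : 0 ≤ s) : HasDerivWithinAt (fun s => ‖(B s : L2V Ω)‖ ^ 2)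
      (-2 * τ * crossNormSq (j s : L2V Ω) (H s)) (Ici 0) s := by
    refine (h.hasDerivWithinAt_B hs).norm_sq.congr_deriv ?_
    rw [inner_neg_right, h.inner_B_wCurl_E hs]
    ring
  rw [← intervalIntegral.integral_const_mul]
  exact (intervalIntegral.integral_eq_sub_of_hasDeriv_right_of_le ht
    (fun s hs => (hderiv s hs.1).continuousWithinAt.mono Icc_subset_Ici_self)
    (fun s hs => (hderiv s hs.1.le).mono fun x hx => hs.1.le.trans (le_of_lt hx))
    ((h.intervalIntegrable_crossNormSq hτ ht).const_mul _)).symm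

/-- Integrating `∂ₜA = -E` (the temporal gauge) produces potentials of all `B(t)` from one of
`B₀`. -/
theorem exists_temporal_gauge (hΩ : IsOpen Ω) (h : IsSolution X τ B₀ B E j H) {A₀ : L2V Ω}
    (hA₀ : IsPotential X B₀ A₀) :
    ∃ A : ℝ → L2V Ω, (∀ t, 0 ≤ t → HasDerivWithinAt A (-(E t : L2V Ω)) (Ici 0) t) ∧
      ∀ t, 0 ≤ t → IsPotential X (B t) (A t) := by
  have := X.finite1
  have : CompleteSpace X.V1 := FiniteDimensional.complete ℝ X.V1
  obtain ⟨A, hA0, hAderiv⟩ :=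
    exists_hasDerivWithinAt_of_continuousOn_Ici h.continuousOn_E.neg ⟨A₀, hA₀.1⟩
  have hA (t : ℝ) (ht : 0 ≤ t) :
      HasDerivWithinAt (fun s => (A s : L2V Ω)) (-(E t : L2V Ω)) (Ici 0) t :=
    X.V1.subtypeL.hasFDerivAt.comp_hasDerivWithinAt t (hAderiv t ht)
  have hinit : HasWeakCurl Ω (A 0) (B 0) := by
    rw [hA0, h.initial]
    exact hA₀.hasWeakCurl
  exact ⟨fun t => A t, hA, fun t ht => ⟨(A t).2, HasWeakCurl.wCurl_eq hΩ <|
    .of_hasDerivWithinAt hA (fun _ => h.hasDerivWithinAt_B)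
      (fun s _ => (X.mem1 _ (E s).2).1.hasWeakCurl_wCurl.neg) hinit ht⟩⟩

theorem helicity_eq (hΩ : IsOpen Ω) (hb : Bornology.IsBounded Ω)
    (h : IsSolution X τ B₀ B E j H) (ht : 0 ≤ t) {A A₀ : L2V Ω}
    (hA : IsPotential X (B t) A) (hA₀ : IsPotential X (B 0) A₀) :
    ⟪A, (B t : L2V Ω)⟫ = ⟪A₀, (B 0 : L2V Ω)⟫ := by
  obtain ⟨a, ha, haB⟩ := h.exists_temporal_gauge hΩ (h.initial ▸ hA₀)
  rw [hA.inner_eq hΩ.measurableSet hb (haB t ht),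
    hA₀.inner_eq hΩ.measurableSet hb (haB 0 le_rfl)]
  refine eq_of_hasDerivWithinAt_zero (f := fun s => ⟪a s, (B s : L2V Ω)⟫) (fun s hs => ?_) ht
  have hsymm := (X.mem1 _ (E s).2).inner_wCurl_comm hΩ.measurableSet hb (X.mem1 _ (haB s hs).1)
  rw [(haB s hs).2, h.inner_B_E hs] at hsymm
  refine ((ha s hs).inner ℝ (h.hasDerivWithinAt_B hs)).congr_deriv ?_
  rw [inner_neg_right, ← hsymm, inner_neg_left, real_inner_comm, h.inner_B_E hs]
  simp

end IsSolution

end MagnetoFriction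

end

open MagnetoFriction in
theorem theorem3p1_general {Ω : Set R3} (hΩ : IsOpen Ω) (hb : Bornology.IsBounded Ω) :
    ∃ C : ℝ, 0 < C ∧
      ∀ (X : DiscreteComplex Ω) (τ : ℝ), 0 < τ →
      ∀ (B₀ : X.V2) (B : ℝ → X.V2) (E j H : ℝ → X.V1), IsSolution X τ B₀ B E j H →
        (∀ t, 0 ≤ t → (timeDeriv B t : L2V Ω) + wCurl Ω (E t) = 0) ∧
        (∀ t, 0 ≤ t → wDiv Ω (B t) = wDiv Ω B₀) ∧
        (∀ t, 0 ≤ t →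
          IntervalIntegrable (fun s => crossNormSq (j s : L2V Ω) (H s)) MeasureTheory.volume 0 t ∧
          ‖(B t : L2V Ω)‖ ^ 2 - ‖(B 0 : L2V Ω)‖ ^ 2
            = -2 * τ * ∫ s in (0 : ℝ)..t, crossNormSq (j s : L2V Ω) (H s) ∧
          -2 * τ * ∫ s in (0 : ℝ)..t, crossNormSq (j s : L2V Ω) (H s) ≤ 0) ∧
        ((∃ A₀, IsPotential X (B₀ : L2V Ω) A₀) →
          (∀ t, 0 ≤ t → wDiv Ω (B t) = 0) ∧
          (∀ t, 0 ≤ t → (∃ A, IsPotential X (B t) A) ∧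
            ∀ A A', IsPotential X (B t) A → IsPotential X (B t) A' →
              inner ℝ A (B t : L2V Ω) = inner ℝ A' (B t : L2V Ω)) ∧
          (∀ t, 0 ≤ t → ∀ A A₀, IsPotential X (B t) A → IsPotential X (B 0) A₀ →
            inner ℝ A (B t : L2V Ω) - inner ℝ A₀ (B 0 : L2V Ω) = 0) ∧
          (∀ t, 0 ≤ t → ∀ A, IsPotential X (B t) A →
            C * |inner ℝ A (B t : L2V Ω)| ≤ ‖(B t : L2V Ω)‖ ^ 2)) := by
  obtain ⟨C, hC, hArnold⟩ := exists_forall_mul_abs_inner_wCurl_le hΩ.measurableSet hb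
  refine ⟨C, hC, fun X τ hτ B₀ B E j H h => ⟨fun t ht => h.timeDeriv_add_wCurl ht,
    fun t ht => h.wDiv_eq hΩ ht, fun t ht => ⟨h.intervalIntegrable_crossNormSq hτ.ne' ht,
      h.norm_sq_sub_norm_sq hτ.ne' ht, ?_⟩, ?_⟩⟩
  · have hdissipation : 0 ≤ ∫ s in (0 : ℝ)..t, crossNormSq (j s : L2V Ω) (H s) :=
      intervalIntegral.integral_nonneg ht fun s _ =>
        MeasureTheory.integral_nonneg fun x => sq_nonneg _
    rw [neg_mul, neg_mul]
    exact neg_nonpos.2 (by positivity)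
  · rintro ⟨A₀, hA₀⟩
    obtain ⟨A, -, hA⟩ := h.exists_temporal_gauge hΩ hA₀
    refine ⟨fun t ht => (hA t ht).wDiv_eq_zero hΩ,
      fun t ht => ⟨⟨A t, hA t ht⟩, fun _ _ ha ha' => ha.inner_eq hΩ.measurableSet hb ha'⟩,
      fun t ht _ _ ha ha₀ => sub_eq_zero.2 (h.helicity_eq hΩ hb ht ha ha₀), ?_⟩
    rintro t - a ⟨ha, hcurl⟩
    exact hcurl ▸ hArnold a (X.mem1 a ha)

open MagnetoFriction in
theorem theorem3p1 (Ω : Set R3) (hΩ : IsBoundedLipschitzDomain Ω) (hc : ContractibleSpace Ω) :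
    ∃ C : ℝ, 0 < C ∧
      ∀ (X : DiscreteComplex Ω), X.IsExact →
      ∀ (τ : ℝ), 0 < τ →
      ∀ (B₀ : X.V2) (B : ℝ → X.V2) (E j H : ℝ → X.V1), IsSolution X τ B₀ B E j H →
        -- magnetic advection equation
        (∀ t, 0 ≤ t → (timeDeriv B t : L2V Ω) + wCurl Ω (E t) = 0) ∧
        -- preservation of the divergence
        (∀ t, 0 ≤ t → wDiv Ω (B t) = wDiv Ω B₀) ∧
        -- energy dissipation
        (∀ t, 0 ≤ t →
          IntervalIntegrable (fun s => crossNormSq (j s : L2V Ω) (H s)) MeasureTheory.volume 0 t ∧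
          ‖(B t : L2V Ω)‖ ^ 2 - ‖(B 0 : L2V Ω)‖ ^ 2
            = -2 * τ * ∫ s in (0 : ℝ)..t, crossNormSq (j s : L2V Ω) (H s) ∧
          -2 * τ * ∫ s in (0 : ℝ)..t, crossNormSq (j s : L2V Ω) (H s) ≤ 0) ∧
        (wDiv Ω B₀ = 0 →
          -- magnetic Gauss law
          (∀ t, 0 ≤ t → wDiv Ω (B t) = 0) ∧
          -- existence of a discrete potential, and independence of the helicity of its choice
          (∀ t, 0 ≤ t → (∃ A, IsPotential X (B t) A) ∧
            ∀ A A', IsPotential X (B t) A → IsPotential X (B t) A' →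
              inner ℝ A (B t : L2V Ω) = inner ℝ A' (B t : L2V Ω)) ∧
          -- helicity conservation
          (∀ t, 0 ≤ t → ∀ A A₀, IsPotential X (B t) A → IsPotential X (B 0) A₀ →
            inner ℝ A (B t : L2V Ω) - inner ℝ A₀ (B 0 : L2V Ω) = 0) ∧
          -- discrete Arnold inequality
          (∀ t, 0 ≤ t → ∀ A, IsPotential X (B t) A →
            C * |inner ℝ A (B t : L2V Ω)| ≤ ‖(B t : L2V Ω)‖ ^ 2)) := by
  obtain ⟨C, hC, h⟩ := theorem3p1_general hΩ.isOpen hΩ.isBounded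
  refine ⟨C, hC, fun X hX τ hτ B₀ B E j H hs => ?_⟩
  obtain ⟨h1, h2, h3, h4⟩ := h X τ hτ B₀ B E j H hs
  exact ⟨h1, h2, h3, fun h0 => h4 ((hX.exact2 _ B₀.2).1 h0)⟩
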